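/- For $n\ge 0$ let $L_n$ be the linear hexagonal chain with $n$ hexagons: its vertices are $p_0,\dots,p_n$, $q_0,\dots,q_n$, $u_0,\dots,u_{n-1}$, $v_0,\dots,v_{n-1}$ and its edges are $p_iq_i$ $(0\le i\le n)$ and $p_iu_i,\ u_ip_{i+1},\ q_iv_i,\ v_iq_{i+1}$ $(0\le i\le n-1)$. Let $r(x,y)$ be the resistance distance in $L_n$ between the vertices $x$ and $y$, i.e. the effective resistance when every edge is a unit resistor. In what follows $j,k\ge 0$ are integers. **1. $p$–$p$ pairs.** (i) For every $k$ with $1\le k\le n$, $$r(p_0,p_k)>r(p_1,p_{1+k})>\dots>r(p_{\lfloor\frac{n-k}2\rfloor},p_{\lfloor\frac{n-k}2\rfloor+k})=r(p_{\lceil\frac{n-k}2\rceil},p_{\lceil\frac{n-k}2\rceil+k})<\dots<r(p_{n-k},p_n).$$ (ii) For fixed $j$, $r(p_j,p_{j+k})$ is strictly increasing in $k$ for $1\le k\le n-j$. (iii) $r(p_{\lfloor\frac{n-k}2\rfloor},p_{\lfloor\frac{n-k}2\rfloor+k})$ is strictly increasing in $k$ for $1\le k\le n$. **2. $q$–$p$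 pairs.** (i) For every $k$ with $0\le k\le n$, $$r(q_0,p_k)>r(q_1,p_{1+k})>\dots>r(q_{\lfloor\frac{n-k}2\rfloor},p_{\lfloor\frac{n-k}2\rfloor+k})=r(q_{\lceil\frac{n-k}2\rceil},p_{\lceil\frac{n-k}2\rceil+k})<\dots<r(q_{n-k},p_n).$$ (ii) For fixed $j$, $r(q_j,p_{j+k})$ is strictly increasing in $k$ for $0\le k\le n-j$. (iii) $r(q_{\lfloor\frac{n-k}2\rfloor},p_{\lfloor\frac{n-k}2\rfloor+k})$ is strictly increasing in $k$ for $0\le k\le n$. **3. $u$–$u$ and $v$–$u$ pairs.** Let $x$ stand for $u$ or for $v$. (i) For every $k$ with $0\le k\le n-1$ (and $k\geq 1$ if $x=u$), with $m=n-1-k$, $$r(x_0,u_k)>r(x_1,u_{1+k})>\dots>r(x_{\lfloor\frac m2\rfloor},u_{\lfloor\frac m2\rfloor+k})=r(x_{\lceil\frac m2\rceil},u_{\lceil\frac m2\rceil+k})<\dots<r(x_{m},u_{n-1}).$$ (ii) For fixed $j$, $r(x_j,u_{j+k})$ is strictly increasing in $k$ for $0\le k\le n-1-j$. (iii) $r(x_{\lfloor\frac{n-k}2\rfloor},u_{\lfloor\frac{n-k}2\rfloor+k})$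 is strictly increasing in $k$ for $0\le k\le n-1$ (note that $\lfloor\frac{n-k}2\rfloor=\lceil\frac m2\rceil$). **4. $p$–$u$ and $p$–$v$ pairs.** Let $y$ stand for $u$ or for $v$. (i) For every $k$ with $0\le k\le n-1$ (and $k\ge 1$ if $y=u$), $$r(p_0,y_k)>r(p_1,y_{1+k})>\dots>r(p_{\lfloor\frac{n-k}2\rfloor},y_{\lfloor\frac{n-k}2\rfloor+k})<\dots<r(p_{n-1-k},y_{n-1}).$$ For $y=u$, $k=0$ and $n\ge1$, $$r(p_0,u_0)>r(p_1,u_1)>\dots>r(p_{\lfloor\frac{n-1}2\rfloor},u_{\lfloor\frac{n-1}2\rfloor})=r(p_{\lfloor\frac n2\rfloor},u_{\lfloor\frac n2\rfloor})<\dots<r(p_{n-1},u_{n-1}).$$ (ii) For fixed $j$, $r(p_j,y_{j+k})$ is strictly increasing in $k$ for $0\le k\le n-1-j$. (iii) Both $r(p_{\lfloor\frac{n-1-k}2\rfloor},y_{\lfloor\frac{n-1-k}2\rfloor+k})$ and $r(p_{\lfloor\frac{n-k}2\rfloor},y_{\lfloor\frac{n-k}2\rfloor+k})$ are strictly increasing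 in $k$ for $0\le k\le n-1$. -/

import Mathlib

/-- `f` is a potential for a unit current that enters the network at `a` and leaves it at `b`, every
edge of the graph `G` being a unit resistor: by Ohm's and Kirchhoff's laws the net current
`∑ y ~ x, (f x - f y) = (L f) x` out of `x` is `1` at `a`, `-1` at `b`, and `0` elsewhere
(it vanishes everywhere if `a = b`); `L` is the Laplacian of `G`. -/
def IsUnitPotential {V : Type*} [Fintype V] [DecidableEq V] (G : SimpleGraph V)
    [DecidableRel G.Adj] (a b : V) (f : V → ℝ) : Prop :=
  Matrix.mulVec (G.lapMatrix ℝ) f = Pi.single a 1 - Pi.single b 1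

open Classical in
/-- The resistance distance (effective resistance) between `a` and `b`: the potential difference
between `a` and `b` under a unit current from `a` to `b`. It does not depend on the potential, see
`effectiveResistance_eq`; a potential exists whenever `a` and `b` are in the same component
(otherwise the value is the junk value `0`). -/
noncomputable def effectiveResistance {V : Type*} [Fintype V] [DecidableEq V] (G : SimpleGraph V)
    [DecidableRel G.Adj] (a b : V) : ℝ :=
  if h : ∃ f, IsUnitPotential G a b f then h.choose a - h.choose b else 0

theorem effectiveResistance_eq {V : Type*} [Fintype V] [DecidableEq V] (G : SimpleGraph V)
    [DecidableRel G.Adj] {a b : V} {f : V → ℝ} (hf : IsUnitPotential G a b f) :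
    effectiveResistance G a b = f a - f b := by
  have h : ∃ f, IsUnitPotential G a b f := ⟨f, hf⟩
  have key : ∀ x y : V → ℝ, x ⬝ᵥ Matrix.mulVec (G.lapMatrix ℝ) y
      = Matrix.mulVec (G.lapMatrix ℝ) x ⬝ᵥ y := by
    intro x y
    rw [Matrix.dotProduct_mulVec, ← Matrix.mulVec_transpose, (SimpleGraph.isSymm_lapMatrix (R := ℝ) G).eq]
  have h1 := key h.choose f
  rw [hf, h.choose_spec] at h1
  simp only [dotProduct_sub, sub_dotProduct, dotProduct_single_one, single_one_dotProduct] at h1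
  rw [effectiveResistance, dif_pos h, h1]

/-- The `4 n + 2` vertices `p_0, …, p_n`, `q_0, …, q_n`, `u_0, …, u_{n-1}`, `v_0, …, v_{n-1}` of the
linear hexagonal chain with `n` hexagons. -/
inductive HexVertex (n : ℕ)
  | p (i : Fin (n + 1))
  | q (i : Fin (n + 1))
  | u (i : Fin n)
  | v (i : Fin n)
  deriving DecidableEq, Fintype

/-- The edges `p_i q_i`, `p_i u_i`, `u_i p_{i+1}`, `q_i v_i`, `v_i q_{i+1}` (listed in one direction);
the hexagon number `i + 1` is `p_i, u_i, p_{i+1}, q_{i+1}, v_i, q_i`. -/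
def HexVertex.Edge {n : ℕ} : HexVertex n → HexVertex n → Prop
  | .p i, .q j => i = j
  | .p i, .u j => i = j.castSucc ∨ i = j.succ
  | .q i, .v j => i = j.castSucc ∨ i = j.succ
  | _, _ => False

instance HexVertex.decidableEdge {n : ℕ} : DecidableRel (HexVertex.Edge (n := n)) := by
  intro x y
  cases x <;> cases y <;> unfold HexVertex.Edge <;> infer_instance

/-- The linear hexagonal chain `L_n` with `n` hexagons. -/
def linHexChain (n : ℕ) : SimpleGraph (HexVertex n) :=
  SimpleGraph.fromRel HexVertex.Edge

instance linHexChain.decidableAdj (n : ℕ) : DecidableRel (linHexChain n).Adj := by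
  unfold linHexChain
  infer_instance

/-- The resistance distance `r_{L_n}(x, y)` in the linear hexagonal chain `L_n`. -/
noncomputable def rL (n : ℕ) (x y : HexVertex n) : ℝ :=
  effectiveResistance (linHexChain n) x y

/-- The vertex `p_i`, where `i ≤ n`. -/
def pL {n : ℕ} (i : ℕ) (h : i ≤ n := by omega) : HexVertex n := .p ⟨i, Nat.lt_succ_of_le h⟩

/-- The vertex `q_i`, where `i ≤ n`. -/
def qL {n : ℕ} (i : ℕ) (h : i ≤ n := by omega) : HexVertex n := .q ⟨i, Nat.lt_succ_of_le h⟩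

/-- The vertex `u_i`, where `i < n`. -/
def uL {n : ℕ} (i : ℕ) (h : i < n := by omega) : HexVertex n := .u ⟨i, h⟩

/-- The vertex `v_i`, where `i < n`. -/
def vL {n : ℕ} (i : ℕ) (h : i < n := by omega) : HexVertex n := .v ⟨i, h⟩

/-!
Number the vertices along the chain by positions `0, …, 2 n`, with `p_i`, `q_i` at `2 i` and `u_i`,
`v_i` at `2 i + 1`. The swap `p ↔ q`, `u ↔ v` splits a unit current into a symmetric part, which
sees a path of unit resistors, and an antisymmetric part, which sees the same path with every even
position grounded through a conductance `2` (`linHexChain_lapMatrix_mulVec`). Hence, for positions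
`a ≤ b` (`rL_eq_chainResistance`),

  `r = (b - a) / 2 + (g a a + g b b) / 2 - σ * g a b`,

where `g` is the Green's function of the grounded path and `σ = 1` or `-1` for vertices on the same
or on opposite sides. It is explicit: `g a b = φ a * φ (2 n - b) / W`, where
`φ m = w m * cosh ((m + 1) t)` with `sinh t = 1`, `cosh t = √2`, and weight `w m = 1 / √2` or `1`
for `m` even or odd (`greenFactor`, `greenFn_equation`).

Shifting both ends by `2` changes `r` by a combination of `sinh ((a + b + 2 - 2 n) t ± (b - a) t)`
and `sinh ((a + b + 2 - 2 n) t)` (`chainResistance_add_two_sub`). For `a`, `b` of the same parity it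
is a positive multiple of the latter, and its sign is that of `a + b + 2 - 2 n`; for a mixed pair a
further `cosh` term appears, which is too small to matter except for `p_i`, `u_i`, where it moves
the centre of symmetry. The equalities at the centre between pairs of the same parity come from the
reflection of the chain (`chainResistance_reflect`), the one for `p_i`, `u_i` from the vanishing of
this increment.

Moving one end outwards by `2` increases `r`: this comes down to an inequality between values of `φ`
(`three_mul_greenFactor_lt`) that follows from `φ (m + 4) = 6 φ (m + 2) - φ m`. As the central
pairs have nested intervals of positions, `chainResistance_lt_of_nested` covers both the
monotonicity in `k` for a fixed end and that of the central values.
-/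

/-! ### Hyperbolic functions at `arsinh 1` -/

open Real in
theorem cosh_arsinh_one : cosh (arsinh 1) = √2 := by
  rw [cosh_arsinh]; norm_num

/-! ### The solution of the homogeneous equation -/

/-- The weight `w m` of a position on the path: `1 / √2` at the even positions, which carry the
rungs `p_i q_i`, and `1` at the odd ones. It turns the recurrence with alternating coefficients
for `greenFactor` into the addition formula for `cosh`. -/
noncomputable def greenWeight (m : ℤ) : ℝ := if Even m then 1 / √2 else 1

/-- The function `φ m = w m * cosh ((m + 1) t)`, where `sinh t = 1`. It solves the homogeneous
equation on the path with a grounding conductance `2` at each even position, and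
`φ (-1) = φ 0` expresses that the path has an end at `0`. -/
noncomputable def greenFactor (m : ℤ) : ℝ := greenWeight m * Real.cosh ((m + 1) * Real.arsinh 1)

theorem greenFactor_even {m : ℤ} (h : Even m) :
    greenFactor m = Real.cosh ((m + 1) * Real.arsinh 1) / √2 := by
  rw [greenFactor, greenWeight, if_pos h]; ring

theorem greenFactor_odd {m : ℤ} (h : ¬ Even m) :
    greenFactor m = Real.cosh ((m + 1) * Real.arsinh 1) := by
  rw [greenFactor, greenWeight, if_neg h]; ring

theorem cosh_add_arsinh_one (x : ℝ) :
    Real.cosh (x + Real.arsinh 1) = √2 * Real.cosh x + Real.sinh x := by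
  rw [Real.cosh_add, cosh_arsinh_one, Real.sinh_arsinh]; ring

theorem cosh_sub_arsinh_one (x : ℝ) :
    Real.cosh (x - Real.arsinh 1) = √2 * Real.cosh x - Real.sinh x := by
  rw [Real.cosh_sub, cosh_arsinh_one, Real.sinh_arsinh]; ring

theorem greenFactor_pos (m : ℤ) : 0 < greenFactor m := by
  unfold greenFactor greenWeight
  have := Real.cosh_pos ((m + 1) * Real.arsinh 1)
  split_ifs <;> positivity

theorem greenFactor_sub_one_add_add_one (m : ℤ) :
    greenFactor (m - 1) + greenFactor (m + 1) = (2 + if Even m then 2 else 0) * greenFactor m := by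
  have h2 : √2 * √2 = 2 := Real.mul_self_sqrt (by norm_num)
  have e1 : (((m - 1 : ℤ) : ℝ) + 1) * Real.arsinh 1 = (m + 1) * Real.arsinh 1 - Real.arsinh 1 := by
    push_cast; ring
  have e2 : (((m + 1 : ℤ) : ℝ) + 1) * Real.arsinh 1 = (m + 1) * Real.arsinh 1 + Real.arsinh 1 := by
    push_cast; ring
  by_cases h : Even m
  · rw [greenFactor_odd (by grind), greenFactor_odd (by grind), greenFactor_even h, e1, e2,
      cosh_add_arsinh_one, cosh_sub_arsinh_one, if_pos h]
    field_simp
    linear_combination (2 * Real.cosh ((m + 1) * Real.arsinh 1)) * h2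
  · rw [greenFactor_even (by grind), greenFactor_even (by grind), greenFactor_odd h, e1, e2,
      cosh_add_arsinh_one, cosh_sub_arsinh_one, if_neg h]
    field_simp
    ring

theorem greenFactor_add_four (m : ℤ) :
    greenFactor (m + 4) = 6 * greenFactor (m + 2) - greenFactor m := by
  have h1 := greenFactor_sub_one_add_add_one (m + 1)
  have h2 := greenFactor_sub_one_add_add_one (m + 2)
  have h3 := greenFactor_sub_one_add_add_one (m + 3)
  rw [show m + 1 - 1 = m by ring, show m + 1 + 1 = m + 2 by ring] at h1
  rw [show m + 2 - 1 = m + 1 by ring, show m + 2 + 1 = m + 3 by ring] at h2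
  rw [show m + 3 - 1 = m + 2 by ring, show m + 3 + 1 = m + 4 by ring] at h3
  by_cases h : Even m
  · rw [if_neg (by grind)] at h1 h3
    rw [if_pos (by grind)] at h2
    linarith
  · rw [if_pos (by grind)] at h1 h3
    rw [if_neg (by grind)] at h2
    linarith

theorem greenFactor_neg_one : greenFactor (-1) = greenFactor 0 := by
  rw [greenFactor_odd (by decide), greenFactor_even (by decide)]
  have : √2 ≠ 0 := by positivity
  simp only [Int.reduceNeg, Int.cast_neg, Int.cast_one, neg_add_cancel, zero_mul, Real.cosh_zero,
    Int.cast_zero, zero_add, one_mul, cosh_arsinh_one, div_self this]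

theorem greenFactor_le_succ {m : ℤ} (hm : -1 ≤ m) : greenFactor m ≤ greenFactor (m + 1) := by
  induction m, hm using Int.leInduction with
  | base => exact greenFactor_neg_one.le
  | succ k _ ih =>
    have h := greenFactor_sub_one_add_add_one (k + 1)
    rw [add_sub_cancel_right] at h
    have := greenFactor_pos (k + 1)
    split_ifs at h <;> linarith

theorem greenFactor_mono {a b : ℤ} (ha : -1 ≤ a) (h : a ≤ b) : greenFactor a ≤ greenFactor b := by
  induction b, h using Int.leInduction with
  | base => exact le_rfl
  | succ k hk ih => exact ih.trans (greenFactor_le_succ (by omega))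

/-! ### The Green's function of the grounded path -/

/-- The Wronskian of the two solutions `φ m` and `φ (2 n - m)`, which are adapted to the two ends of
the path `0, …, 2 n`; see `greenWronskian_eq`. -/
noncomputable def greenWronskian (n : ℕ) : ℝ := Real.sinh ((2 * n + 2) * Real.arsinh 1) / √2

theorem greenWronskian_pos (n : ℕ) : 0 < greenWronskian n := by
  have : 0 < Real.sinh ((2 * n + 2) * Real.arsinh 1) :=
    Real.sinh_pos_iff.2 (mul_pos (by positivity) (Real.arsinh_pos_iff.2 one_pos))
  unfold greenWronskian
  positivity

theorem greenWronskian_eq (n : ℕ) (a : ℤ) :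
    greenFactor (a + 1) * greenFactor (2 * n - a) - greenFactor a * greenFactor (2 * n - a - 1)
      = greenWronskian n := by
  set t := Real.arsinh 1 with ht
  have key : Real.cosh ((a + 1) * t + t) * Real.cosh ((2 * n - a + 1) * t)
      - Real.cosh ((a + 1) * t) * Real.cosh ((2 * n - a + 1) * t - t)
      = Real.sinh ((2 * n + 2) * t) := by
    rw [show ((2 * n + 2) * t : ℝ) = (a + 1) * t + (2 * n - a + 1) * t by ring, Real.sinh_add,
      cosh_add_arsinh_one, cosh_sub_arsinh_one]
    ring
  have e1 : (((a + 1 : ℤ) : ℝ) + 1) * t = (a + 1) * t + t := by push_cast; ring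
  have e2 : (((2 * n - a : ℤ) : ℝ) + 1) * t = (2 * n - a + 1) * t := by push_cast; ring
  have e3 : (((2 * n - a - 1 : ℤ) : ℝ) + 1) * t = (2 * n - a + 1) * t - t := by push_cast; ring
  rw [greenWronskian, ← key]
  by_cases h : Even a
  · rw [greenFactor_odd (by grind), greenFactor_even (m := 2 * n - a) (by grind),
      greenFactor_even h, greenFactor_odd (by grind), ← ht, e1, e2, e3]
    ring
  · rw [greenFactor_even (by grind), greenFactor_odd (m := 2 * n - a) (by grind),
      greenFactor_odd h, greenFactor_even (by grind), ← ht, e1, e2, e3]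
    ring

/-- The Green's function of the grounded path `0, …, 2 n` (a unit resistor between neighbours and a
conductance `2` to the ground at each even position): the potential at `b` caused by a unit current
injected at `a`. Positions are integers, so that the ends of the path turn into the reflecting
conditions `greenFn_neg_one` and `greenFn_last_add_one`. -/
noncomputable def greenFn (n : ℕ) (a b : ℤ) : ℝ :=
  greenFactor (min a b) * greenFactor (2 * n - max a b) / greenWronskian n

theorem greenFn_comm (n : ℕ) (a b : ℤ) : greenFn n a b = greenFn n b a := by
  rw [greenFn, greenFn, min_comm, max_comm]

theorem greenFn_of_le (n : ℕ) {a b : ℤ} (h : a ≤ b) :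
    greenFn n a b = greenFactor a * greenFactor (2 * n - b) / greenWronskian n := by
  rw [greenFn, min_eq_left h, max_eq_right h]

theorem greenFn_reflect (n : ℕ) (a b : ℤ) :
    greenFn n (2 * n - b) (2 * n - a) = greenFn n a b := by
  rcases le_total a b with h | h
  · rw [greenFn_of_le n h, greenFn_of_le n (by omega), sub_sub_cancel, mul_comm (greenFactor a)]
  · rw [greenFn_comm, greenFn_comm n a, greenFn_of_le n h, greenFn_of_le n (by omega),
      sub_sub_cancel, mul_comm (greenFactor b)]

theorem greenFn_equation (n : ℕ) (a m : ℤ) :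
    (2 + if Even m then 2 else 0) * greenFn n a m - greenFn n a (m - 1) - greenFn n a (m + 1)
      = if m = a then 1 else 0 := by
  have hr := greenFactor_sub_one_add_add_one m
  have hW := (greenWronskian_pos n).ne'
  rcases lt_trichotomy m a with h | h | h
  · rw [greenFn_comm n a m, greenFn_comm n a (m - 1), greenFn_comm n a (m + 1),
      greenFn_of_le n (by omega), greenFn_of_le n (by omega), greenFn_of_le n (by omega),
      if_neg (show ¬m = a by omega)]
    field_simp
    linear_combination -greenFactor (2 * n - a) * hr
  · subst h
    have hw := greenWronskian_eq n m
    rw [greenFn_comm n m (m - 1), greenFn_of_le n le_rfl, greenFn_of_le n (by omega),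
      greenFn_of_le n (by omega), if_pos rfl, show (2 * n - (m + 1) : ℤ) = 2 * n - m - 1 by ring]
    field_simp
    linear_combination -greenFactor (2 * n - m) * hr + hw
  · have hr := greenFactor_sub_one_add_add_one (2 * n - m)
    have hp : Even (2 * n - m) ↔ Even m := by grind
    simp only [hp] at hr
    rw [greenFn_of_le n (by omega), greenFn_of_le n (by omega), greenFn_of_le n (by omega),
      if_neg (show ¬m = a by omega), show (2 * n - (m + 1) : ℤ) = 2 * n - m - 1 by ring,
      show (2 * n - (m - 1) : ℤ) = 2 * n - m + 1 by ring]
    field_simp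
    linear_combination -greenFactor a * hr

theorem greenFn_neg_one (n : ℕ) {a : ℤ} (ha : 0 ≤ a) : greenFn n a (-1) = greenFn n a 0 := by
  rw [greenFn_comm, greenFn_comm n a, greenFn_of_le n (by omega), greenFn_of_le n ha,
    greenFactor_neg_one]

theorem greenFn_last_add_one (n : ℕ) {a : ℤ} (ha : a ≤ 2 * n) :
    greenFn n a (2 * n + 1) = greenFn n a (2 * n) := by
  rw [greenFn_of_le n (by omega), greenFn_of_le n ha, sub_self, ← greenFactor_neg_one]
  congr 3
  ring

/-! ### The Laplacian of the chain -/

namespace HexVertex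

/-- The position of a vertex along the chain: `2 i` for `p_i` and `q_i`, and `2 i + 1` for `u_i` and
`v_i`. -/
def pos {n : ℕ} : HexVertex n → ℤ
  | .p i => 2 * (i : ℕ)
  | .q i => 2 * (i : ℕ)
  | .u i => 2 * (i : ℕ) + 1
  | .v i => 2 * (i : ℕ) + 1

/-- The side of the chain: `1` for `p_i` and `u_i`, and `-1` for `q_i` and `v_i`. -/
def side {n : ℕ} : HexVertex n → ℝ
  | .p _ => 1
  | .q _ => -1
  | .u _ => 1
  | .v _ => -1

theorem sum_univ {n : ℕ} (f : HexVertex n → ℝ) :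
    ∑ x, f x = ∑ i, f (.p i) + ∑ i, f (.q i) + ∑ i, f (.u i) + ∑ i, f (.v i) := by
  let e : ((Fin (n + 1) ⊕ Fin (n + 1)) ⊕ Fin n) ⊕ Fin n ≃ HexVertex n :=
    { toFun := Sum.elim (Sum.elim (Sum.elim .p .q) .u) .v
      invFun := fun
        | .p i => .inl (.inl (.inl i))
        | .q i => .inl (.inl (.inr i))
        | .u i => .inl (.inr i)
        | .v i => .inr i
      left_inv := by rintro (((_ | _) | _) | _) <;> rfl
      right_inv := by rintro (_ | _ | _ | _) <;> rfl }
  rw [← e.sum_comp]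
  simp [e]

end HexVertex

theorem SimpleGraph.lapMatrix_mulVec_eq_sum {V : Type*} [Fintype V] [DecidableEq V]
    (G : SimpleGraph V) [DecidableRel G.Adj] (f : V → ℝ) (x : V) :
    (Matrix.mulVec (G.lapMatrix ℝ) f) x = ∑ y, if G.Adj x y then f x - f y else 0 := by
  rw [SimpleGraph.lapMatrix_mulVec_apply, ← Finset.sum_filter, ← SimpleGraph.neighborFinset_eq_filter,
    Finset.sum_sub_distrib, Finset.sum_const, SimpleGraph.card_neighborFinset_eq_degree,
    nsmul_eq_mul]

theorem sum_ite_castSucc_or_succ {n : ℕ} (H : ℤ → ℝ) (h0 : H (-1) = H 0)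
    (h1 : H (2 * n + 1) = H (2 * n)) (i : Fin (n + 1)) :
    (∑ j : Fin n, if i = j.castSucc ∨ i = j.succ then
        H (2 * (i : ℕ)) - H (2 * (j : ℕ) + 1) else 0)
      = 2 * H (2 * (i : ℕ)) - H (2 * (i : ℕ) - 1) - H (2 * (i : ℕ) + 1) := by
  have hs : ∀ j : Fin n, (if i = j.castSucc ∨ i = j.succ then
        H (2 * (i : ℕ)) - H (2 * (j : ℕ) + 1) else 0)
      = (if i = j.succ then H (2 * (i : ℕ)) - H (2 * (j : ℕ) + 1) else 0)
        + (if i = j.castSucc then H (2 * (i : ℕ)) - H (2 * (j : ℕ) + 1) else 0) := by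
    intro j
    by_cases h : i = j.castSucc
    · have : i ≠ j.succ := by rw [h]; exact Fin.castSucc_lt_succ.ne
      rw [if_pos (Or.inl h), if_neg this, if_pos h, zero_add]
    · simp [h]
  have e0 : (∑ j : Fin n, if i = j.succ then H (2 * (i : ℕ)) - H (2 * (j : ℕ) + 1) else 0)
      = H (2 * (i : ℕ)) - H (2 * (i : ℕ) - 1) := by
    cases i using Fin.cases with
    | zero =>
      simp only [(Fin.succ_ne_zero _).symm, if_false, Finset.sum_const_zero]
      simp [h0]
    | succ i =>
      simp only [Fin.succ_inj, Finset.sum_ite_eq, Finset.mem_univ, if_true, Fin.val_succ]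
      congr 2
      push_cast
      ring
  have e1 : (∑ j : Fin n, if i = j.castSucc then H (2 * (i : ℕ)) - H (2 * (j : ℕ) + 1) else 0)
      = H (2 * (i : ℕ)) - H (2 * (i : ℕ) + 1) := by
    cases i using Fin.lastCases with
    | last =>
      simp only [(Fin.castSucc_lt_last _).ne', if_false, Finset.sum_const_zero]
      simp [h1]
    | cast i => simp
  simp_rw [hs, Finset.sum_add_distrib]
  rw [e0, e1]
  ring

theorem sum_ite_eq_castSucc_or_eq_succ {n : ℕ} (F : Fin (n + 1) → ℝ) (i : Fin n) :
    (∑ j : Fin (n + 1), if j = i.castSucc ∨ j = i.succ then F j else 0)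
      = F i.castSucc + F i.succ := by
  have : (Finset.univ.filter fun j : Fin (n + 1) => j = i.castSucc ∨ j = i.succ)
      = {i.castSucc, i.succ} := by ext; simp
  rw [← Finset.sum_filter, this, Finset.sum_pair Fin.castSucc_lt_succ.ne]

/-- The swap `p ↔ q`, `u ↔ v` splits the Laplacian of the chain: on the symmetric functions it is the
Laplacian of the path of positions, on the antisymmetric ones the rungs add `2` to the diagonal at
the even positions. -/
theorem linHexChain_lapMatrix_mulVec {n : ℕ} (K G : ℤ → ℝ) (hK0 : K (-1) = K 0)
    (hKn : K (2 * n + 1) = K (2 * n)) (hG0 : G (-1) = G 0) (hGn : G (2 * n + 1) = G (2 * n))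
    (x : HexVertex n) :
    (Matrix.mulVec ((linHexChain n).lapMatrix ℝ) fun y => K y.pos + y.side * G y.pos) x
      = (2 * K x.pos - K (x.pos - 1) - K (x.pos + 1))
        + x.side * ((2 + if Even x.pos then 2 else 0) * G x.pos
          - G (x.pos - 1) - G (x.pos + 1)) := by
  rw [SimpleGraph.lapMatrix_mulVec_eq_sum, HexVertex.sum_univ]
  have hp := sum_ite_castSucc_or_succ (n := n) (fun m => K m + 1 * G m) (by simp [hK0, hG0])
    (by simp [hKn, hGn])
  have hq := sum_ite_castSucc_or_succ (n := n) (fun m => K m + -1 * G m) (by simp [hK0, hG0])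
    (by simp [hKn, hGn])
  have odd : ∀ m : ℤ, ¬Even (2 * m + 1) := by grind
  cases x with
  | p i =>
    simp only [linHexChain, SimpleGraph.fromRel_adj, HexVertex.Edge, HexVertex.pos,
      HexVertex.side, ne_eq, reduceCtorEq, not_false_eq_true, true_and, or_false,
      and_false, if_false, Finset.sum_const_zero, hp, Finset.sum_ite_eq, Finset.mem_univ, if_true,
      even_two_mul]
    ring
  | q i =>
    simp only [linHexChain, SimpleGraph.fromRel_adj, HexVertex.Edge, HexVertex.pos,
      HexVertex.side, ne_eq, reduceCtorEq, not_false_eq_true, true_and, or_false, false_or,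
      and_false, if_false, Finset.sum_const_zero, hq, Finset.sum_ite_eq', Finset.mem_univ, if_true,
      even_two_mul]
    ring
  | u i =>
    simp only [linHexChain, SimpleGraph.fromRel_adj, HexVertex.Edge, HexVertex.pos,
      HexVertex.side, ne_eq, reduceCtorEq, not_false_eq_true, true_and, or_false, false_or,
      and_false, if_false, Finset.sum_const_zero, sum_ite_eq_castSucc_or_eq_succ, odd,
      Fin.val_castSucc, Fin.val_succ]
    rw [show (2 * ((i : ℕ) + 1 : ℕ) : ℤ) = 2 * (i : ℕ) + 1 + 1 by push_cast; ring,
      add_sub_cancel_right]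
    ring
  | v i =>
    simp only [linHexChain, SimpleGraph.fromRel_adj, HexVertex.Edge, HexVertex.pos,
      HexVertex.side, ne_eq, reduceCtorEq, not_false_eq_true, true_and, or_false, false_or,
      and_false, if_false, Finset.sum_const_zero, sum_ite_eq_castSucc_or_eq_succ, odd,
      Fin.val_castSucc, Fin.val_succ]
    rw [show (2 * ((i : ℕ) + 1 : ℕ) : ℤ) = 2 * (i : ℕ) + 1 + 1 by push_cast; ring,
      add_sub_cancel_right]
    ring

theorem HexVertex.pos_nonneg {n : ℕ} (x : HexVertex n) : 0 ≤ x.pos := by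
  cases x <;> simp only [pos] <;> omega

theorem HexVertex.pos_le {n : ℕ} (x : HexVertex n) : x.pos ≤ 2 * n := by
  cases x <;> simp only [pos] <;> omega

theorem HexVertex.side_mul_self {n : ℕ} (x : HexVertex n) : x.side * x.side = 1 := by
  cases x <;> simp [side]

theorem HexVertex.single_one_apply {n : ℕ} (x y : HexVertex n) :
    (Pi.single x 1 : HexVertex n → ℝ) y
      = (if y.pos = x.pos then 1 else 0) * ((1 + y.side * x.side) / 2) := by
  have ne1 : ∀ a b : ℤ, ¬(2 * a = 2 * b + 1) := by omega
  have ne2 : ∀ a b : ℤ, ¬(2 * a + 1 = 2 * b) := by omega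
  rw [Pi.single_apply]
  cases x <;> cases y <;> simp [pos, side, ne1, ne2, Fin.ext_iff]

/-! ### The resistance distance -/

/-- The resistance between two vertices at positions `a ≤ b`, where `σ = 1` if they lie on the same
side of the chain and `σ = -1` if they lie on opposite sides. -/
noncomputable def chainResistance (n : ℕ) (σ : ℝ) (a b : ℤ) : ℝ :=
  (b - a) / 2 + (greenFn n a a + greenFn n b b) / 2 - σ * greenFn n a b

theorem rL_eq_chainResistance {n : ℕ} {x y : HexVertex n} (h : x.pos ≤ y.pos) :
    rL n x y = chainResistance n (x.side * y.side) x.pos y.pos := by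
  have hx0 := x.pos_nonneg
  have hxn := x.pos_le
  have hy0 := y.pos_nonneg
  have hyn := y.pos_le
  -- the potential is half the one of the symmetrized current, constant outside the interval between
  -- the two positions, plus half the one of the antisymmetrized current
  set K : ℤ → ℝ := fun m => -(min (max m x.pos) y.pos : ℤ) / 2 with hK
  set G : ℤ → ℝ := fun m => (x.side * greenFn n x.pos m - y.side * greenFn n y.pos m) / 2 with hG
  have hf : IsUnitPotential (linHexChain n) x y fun z => K z.pos + z.side * G z.pos := by
    funext z
    rw [linHexChain_lapMatrix_mulVec K G, Pi.sub_apply, HexVertex.single_one_apply,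
      HexVertex.single_one_apply]
    · have hKz : 2 * K z.pos - K (z.pos - 1) - K (z.pos + 1)
          = ((if z.pos = x.pos then 1 else 0) - if z.pos = y.pos then 1 else 0) / 2 := by
        have : -2 * min (max z.pos x.pos) y.pos + min (max (z.pos - 1) x.pos) y.pos
            + min (max (z.pos + 1) x.pos) y.pos
            = ((if z.pos = x.pos then 1 else 0) - if z.pos = y.pos then 1 else 0) := by
          split_ifs <;> omega
        have := congrArg (Int.cast : ℤ → ℝ) this
        push_cast at this
        simp only [hK]
        push_cast
        linarith
      have h1 := greenFn_equation n x.pos z.pos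
      have h2 := greenFn_equation n y.pos z.pos
      rw [hKz]
      simp only [hG]
      linear_combination z.side * x.side / 2 * h1 - z.side * y.side / 2 * h2
    · simp only [hK]; congr 3; omega
    · simp only [hK]; congr 3; omega
    · simp only [hG, greenFn_neg_one n hx0, greenFn_neg_one n hy0]
    · simp only [hG, greenFn_last_add_one n hxn, greenFn_last_add_one n hyn]
  rw [rL, effectiveResistance_eq _ hf, chainResistance]
  simp only [hK, hG]
  rw [show min (max x.pos x.pos) y.pos = x.pos by omega,
    show min (max y.pos x.pos) y.pos = y.pos by omega, greenFn_comm n y.pos x.pos]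
  linear_combination greenFn n x.pos x.pos / 2 * x.side_mul_self
    + greenFn n y.pos y.pos / 2 * y.side_mul_self

theorem chainResistance_reflect (n : ℕ) (σ : ℝ) (a b : ℤ) :
    chainResistance n σ (2 * n - b) (2 * n - a) = chainResistance n σ a b := by
  simp only [chainResistance, greenFn_reflect]
  push_cast
  ring

/-! ### Moving one end outwards -/

/-- The inequality behind the growth of the resistance when one end moves away. Writing `X`, `X''`
for `φ b`, `φ (b + 2)` and `Y`, `Y''` for `φ (2 n - b)`, `φ (2 n - b - 2)`, the Wronskian is
proportional to `X'' Y - X Y''`, so that `5 X ≤ X''` and `Y ≤ 6 Y''` suffice. -/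
theorem three_mul_greenFactor_lt (n : ℕ) {b : ℤ} (hb : 0 ≤ b) (hbn : b + 2 ≤ 2 * n) :
    3 * (greenFactor b * greenFactor (2 * n - b))
      < 2 * greenWronskian n + greenFactor (b + 2) * greenFactor (2 * n - b - 2)
        + 2 * (greenFactor b * greenFactor (2 * n - b - 2)) := by
  have hW := greenWronskian_eq n b
  have hx := greenFactor_sub_one_add_add_one (b + 1)
  have hy := greenFactor_sub_one_add_add_one (2 * n - b - 1)
  have hX := greenFactor_add_four (b - 2)
  rw [show b - 2 + 4 = b + 2 by ring, show b - 2 + 2 = b by ring] at hX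
  rw [show b + 1 - 1 = b by ring, show b + 1 + 1 = b + 2 by ring] at hx
  rw [show 2 * n - b - 1 - 1 = 2 * n - b - 2 by ring,
    show 2 * n - b - 1 + 1 = 2 * n - b by ring] at hy
  have hX0 := greenFactor_pos b
  have hX2 := greenFactor_pos (b + 2)
  have hY0 := greenFactor_pos (2 * n - b)
  have hY2 := greenFactor_pos (2 * n - b - 2)
  have hgrow : 5 * greenFactor b ≤ greenFactor (b + 2) := by
    suffices greenFactor (b - 2) ≤ greenFactor b by linarith
    rcases hb.eq_or_lt with rfl | hb
    · -- `φ (-2) = φ 0` by the reflection symmetry of `φ` about `-1`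
      have := greenFactor_sub_one_add_add_one (-1)
      rw [if_neg (by decide), greenFactor_neg_one] at this
      norm_num at this ⊢
      linarith
    · exact greenFactor_mono (by omega) (by omega)
  by_cases h : Even b
  · rw [if_neg (by grind)] at hx hy
    have : 2 * greenWronskian n = greenFactor (b + 2) * greenFactor (2 * n - b)
        - greenFactor b * greenFactor (2 * n - b - 2) := by
      linear_combination -2 * hW - greenFactor (2 * n - b) * hx + greenFactor b * hy
    nlinarith [mul_le_mul_of_nonneg_right hgrow hY0.le, mul_pos hX0 hY0, mul_pos hX0 hY2,
      mul_pos hX2 hY2]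
  · rw [if_pos (by grind)] at hx hy
    have : 2 * greenWronskian n = (greenFactor (b + 2) * greenFactor (2 * n - b)
        - greenFactor b * greenFactor (2 * n - b - 2)) / 2 := by
      linear_combination -2 * hW - greenFactor (2 * n - b) / 2 * hx + greenFactor b / 2 * hy
    have hY := greenFactor_add_four (2 * n - b - 4)
    rw [show 2 * n - b - 4 + 4 = 2 * n - b by ring,
      show 2 * n - b - 4 + 2 = 2 * n - b - 2 by ring] at hY
    have hY6 : greenFactor (2 * n - b) ≤ 6 * greenFactor (2 * n - b - 2) := by
      linarith [greenFactor_pos (2 * n - b - 4)]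
    nlinarith [mul_le_mul_of_nonneg_right hgrow hY0.le, mul_le_mul_of_nonneg_right hgrow hY2.le,
      mul_le_mul_of_nonneg_left hY6 hX0.le, mul_pos hX0 hY0]

theorem chainResistance_lt_add_two (n : ℕ) {σ : ℝ} (hσ : σ = 1 ∨ σ = -1) {a b : ℤ} (ha : 0 ≤ a)
    (hab : a ≤ b) (hbn : b + 2 ≤ 2 * n) :
    chainResistance n σ a b < chainResistance n σ a (b + 2) := by
  have key := three_mul_greenFactor_lt n (ha.trans hab) hbn
  have hW := greenWronskian_pos n
  have hD : 0 ≤ greenFactor (2 * n - b) - greenFactor (2 * n - b - 2) :=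
    sub_nonneg.2 (greenFactor_mono (by omega) (by omega))
  -- for `σ = -1` the factor `φ a` may be replaced by the larger `φ b`
  have hmul := mul_le_mul_of_nonneg_right (greenFactor_mono (by omega) hab) hD
  have hpos := mul_nonneg (greenFactor_pos a).le hD
  have hbpos := mul_nonneg (greenFactor_pos b).le hD
  have e : chainResistance n σ a (b + 2) - chainResistance n σ a b
      = (2 * greenWronskian n + greenFactor (b + 2) * greenFactor (2 * n - b - 2)
        - greenFactor b * greenFactor (2 * n - b)
        + 2 * σ * (greenFactor a * (greenFactor (2 * n - b) - greenFactor (2 * n - b - 2))))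
        / (2 * greenWronskian n) := by
    simp only [chainResistance]
    rw [greenFn_of_le n le_rfl, greenFn_of_le n le_rfl, greenFn_of_le n le_rfl,
      greenFn_of_le n hab, greenFn_of_le n (show a ≤ b + 2 by omega),
      show (2 * n - (b + 2) : ℤ) = 2 * n - b - 2 by ring]
    field_simp
    push_cast
    ring
  rw [← sub_pos, e]
  apply div_pos _ (by positivity)
  rcases hσ with rfl | rfl <;> linarith

theorem chainResistance_lt_of_lt_right (n : ℕ) {σ : ℝ} (hσ : σ = 1 ∨ σ = -1) {a b b' : ℤ}
    (ha : 0 ≤ a) (hab : a ≤ b) (hb : b < b') (hpar : Even (b' - b)) (hbn : b' ≤ 2 * n) :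
    chainResistance n σ a b < chainResistance n σ a b' := by
  obtain ⟨m, hm⟩ := hpar
  obtain rfl : b' = b + 2 * m := by omega
  have hm1 : 1 ≤ m := by omega
  clear hm hb
  induction m, hm1 using Int.leInduction with
  | base => exact chainResistance_lt_add_two n hσ ha hab (by omega)
  | succ m hm ih =>
    refine (ih (by omega)).trans ?_
    rw [show b + 2 * (m + 1) = b + 2 * m + 2 by ring]
    exact chainResistance_lt_add_two n hσ ha (by omega) (by omega)

theorem chainResistance_lt_of_lt_left (n : ℕ) {σ : ℝ} (hσ : σ = 1 ∨ σ = -1) {a a' b : ℤ}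
    (ha : 0 ≤ a') (haa : a' < a) (hab : a ≤ b) (hpar : Even (a - a')) (hbn : b ≤ 2 * n) :
    chainResistance n σ a b < chainResistance n σ a' b := by
  rw [← chainResistance_reflect, ← chainResistance_reflect n σ a']
  exact chainResistance_lt_of_lt_right n hσ (by omega) (by omega) (by omega)
    (by convert hpar using 1; ring) (by omega)

/-- The resistance grows when the interval of positions is extended, by an even amount at each
end. -/
theorem chainResistance_lt_of_nested (n : ℕ) {σ : ℝ} (hσ : σ = 1 ∨ σ = -1) {a a' b b' : ℤ}
    (ha : 0 ≤ a') (haa : a' ≤ a) (hab : a ≤ b) (hbb : b ≤ b') (hbn : b' ≤ 2 * n)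
    (hne : a' < a ∨ b < b') (hpa : 2 ∣ a - a') (hpb : 2 ∣ b' - b) :
    chainResistance n σ a b < chainResistance n σ a' b' := by
  rw [← even_iff_two_dvd] at hpa hpb
  rcases haa.eq_or_lt with rfl | haa
  · exact chainResistance_lt_of_lt_right n hσ ha hab (by omega) hpb hbn
  · have h := chainResistance_lt_of_lt_left n hσ ha haa hab hpa (by omega)
    rcases hbb.eq_or_lt with rfl | hbb
    · exact h
    · exact h.trans (chainResistance_lt_of_lt_right n hσ ha (by omega) hbb hpb hbn)

/-! ### Shifting both ends -/

theorem greenWeight_add_two (m : ℤ) : greenWeight (m + 2) = greenWeight m := by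
  have : Even (m + 2) ↔ Even m := by grind
  simp only [greenWeight, this]

/-- By the product formula for `cosh`, `greenFn n a b` is, up to weights that depend on parities only,
the sum of a function of `b - a` and one of `a + b`; a shift of both positions changes only the
latter. -/
theorem greenFn_add_two_sub (n : ℕ) {a b : ℤ} (h : a ≤ b) :
    greenFn n (a + 2) (b + 2) - greenFn n a b
      = greenWeight a * greenWeight b * (Real.sinh ((a + b + 2 - 2 * n) * Real.arsinh 1)
        * Real.sinh (2 * Real.arsinh 1)) / greenWronskian n := by
  have hp : ∀ c : ℤ, greenWeight (2 * n - c) = greenWeight c := fun c => by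
    have : Even (2 * n - c) ↔ Even c := by grind
    simp only [greenWeight, this]
  have hg : ∀ m : ℤ, greenFactor m = greenWeight m * Real.cosh ((m + 1) * Real.arsinh 1) :=
    fun m => rfl
  have key : ∀ x y z : ℝ, Real.cosh (x + z) * Real.cosh (y - z) - Real.cosh x * Real.cosh y
      = Real.sinh (x - y + z) * Real.sinh z := by
    intro x y z
    have hz := Real.cosh_sq z
    rw [Real.cosh_add, Real.cosh_sub, Real.sinh_add, Real.sinh_sub, Real.cosh_sub]
    linear_combination Real.cosh x * Real.cosh y * hz
  have := key ((a + 1) * Real.arsinh 1) ((2 * n - b + 1) * Real.arsinh 1) (2 * Real.arsinh 1)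
  rw [greenFn_of_le n h, greenFn_of_le n (by omega), hg, hg, hg, hg, hp, hp, greenWeight_add_two,
    greenWeight_add_two, ← sub_div]
  congr 1
  rw [show ((a + b + 2 - 2 * n) * Real.arsinh 1 : ℝ) = (a + 1) * Real.arsinh 1
      - (2 * n - b + 1) * Real.arsinh 1 + 2 * Real.arsinh 1 by ring, ← this]
  push_cast
  ring_nf

theorem chainResistance_add_two_sub (n : ℕ) (σ : ℝ) {a b : ℤ} (h : a ≤ b) :
    chainResistance n σ (a + 2) (b + 2) - chainResistance n σ a b
      = Real.sinh (2 * Real.arsinh 1) / greenWronskian n *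
        (greenWeight a ^ 2 / 2 * Real.sinh ((a + b + 2 - 2 * n) * Real.arsinh 1
            - (b - a) * Real.arsinh 1)
          + greenWeight b ^ 2 / 2 * Real.sinh ((a + b + 2 - 2 * n) * Real.arsinh 1
            + (b - a) * Real.arsinh 1)
          - σ * (greenWeight a * greenWeight b)
            * Real.sinh ((a + b + 2 - 2 * n) * Real.arsinh 1)) := by
  have h1 := greenFn_add_two_sub n (le_refl a)
  have h2 := greenFn_add_two_sub n (le_refl b)
  have h3 := greenFn_add_two_sub n h
  rw [show ((a + b + 2 - 2 * n) * Real.arsinh 1 - (b - a) * Real.arsinh 1 : ℝ)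
      = (a + a + 2 - 2 * n) * Real.arsinh 1 by ring,
    show ((a + b + 2 - 2 * n) * Real.arsinh 1 + (b - a) * Real.arsinh 1 : ℝ)
      = (b + b + 2 - 2 * n) * Real.arsinh 1 by ring]
  simp only [chainResistance]
  push_cast
  linear_combination h1 / 2 + h2 / 2 - σ * h3

theorem sinh_div_greenWronskian_pos (n : ℕ) :
    0 < Real.sinh (2 * Real.arsinh 1) / greenWronskian n :=
  div_pos (Real.sinh_pos_iff.2 (mul_pos two_pos (Real.arsinh_pos_iff.2 one_pos)))
    (greenWronskian_pos n)

theorem chainResistance_lt_shift_of_even (n : ℕ) {σ : ℝ} {a b a' b' : ℤ} (hpar : 2 ∣ b - a)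
    (hσ : σ = 1 ∧ a < b ∨ σ = -1 ∧ a ≤ b) (hpos : 2 * n < a + b + 2) (ha' : a' = a + 2)
    (hb' : b' = b + 2) : chainResistance n σ a b < chainResistance n σ a' b' := by
  subst ha' hb'
  rw [← even_iff_two_dvd] at hpar
  have ht : 0 < Real.arsinh 1 := Real.arsinh_pos_iff.2 one_pos
  have hw : greenWeight b = greenWeight a := by
    have : Even b ↔ Even a := by grind
    simp only [greenWeight, this]
  have hwa : 0 < greenWeight a := by unfold greenWeight; split_ifs <;> positivity
  have hx : (0 : ℝ) < a + b + 2 - 2 * n := by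
    have : (0 : ℤ) < a + b + 2 - 2 * n := by omega
    exact_mod_cast this
  have hs := Real.sinh_pos_iff.2 (mul_pos hx ht)
  have hc : 0 < Real.cosh ((b - a) * Real.arsinh 1) - σ := by
    rcases hσ with ⟨rfl, h⟩ | ⟨rfl, h⟩
    · rw [sub_pos, Real.one_lt_cosh]
      have : (0 : ℝ) < b - a := by
        have : (0 : ℤ) < b - a := by omega
        exact_mod_cast this
      positivity
    · linarith [Real.cosh_pos ((b - a) * Real.arsinh 1)]
  rw [← sub_pos, chainResistance_add_two_sub n σ (by omega), hw, Real.sinh_add, Real.sinh_sub]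
  apply mul_pos (sinh_div_greenWronskian_pos n)
  have := mul_pos (pow_pos hwa 2) (mul_pos hs hc)
  linarith

theorem chainResistance_shift_lt_of_even (n : ℕ) {σ : ℝ} {a b a' b' : ℤ} (hpar : 2 ∣ b - a)
    (hσ : σ = 1 ∧ a < b ∨ σ = -1 ∧ a ≤ b) (hneg : a + b + 2 < 2 * n) (ha' : a' = a + 2)
    (hb' : b' = b + 2) : chainResistance n σ a' b' < chainResistance n σ a b := by
  rw [← chainResistance_reflect n σ a, ← chainResistance_reflect n σ a']
  exact chainResistance_lt_shift_of_even n (by omega)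
    (hσ.imp (And.imp_right (by omega)) (And.imp_right (by omega))) (by omega) (by omega) (by omega)

theorem chainResistance_add_two_sub_of_odd (n : ℕ) (σ : ℝ) {a b : ℤ} (h : a ≤ b) (ha : Even a)
    (hb : ¬Even b) :
    chainResistance n σ (a + 2) (b + 2) - chainResistance n σ a b
      = Real.sinh (2 * Real.arsinh 1) / greenWronskian n *
        ((3 / 4 * Real.cosh ((b - a) * Real.arsinh 1) - σ * (√2 / 2))
            * Real.sinh ((a + b + 2 - 2 * n) * Real.arsinh 1)
          + 1 / 4 * Real.sinh ((b - a) * Real.arsinh 1)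
            * Real.cosh ((a + b + 2 - 2 * n) * Real.arsinh 1)) := by
  have h2 : (1 / √2) ^ 2 = 1 / 2 := by rw [div_pow, Real.sq_sqrt (by norm_num)]; norm_num
  have h3 : 1 / √2 = √2 / 2 := by rw [div_eq_div_iff (by positivity) two_ne_zero]; norm_num
  rw [chainResistance_add_two_sub n σ h, greenWeight, greenWeight, if_pos ha, if_neg hb, h2, h3,
    Real.sinh_add, Real.sinh_sub]
  ring

theorem arsinh_one_le_mul {x : ℤ} (hx : 1 ≤ x) : Real.arsinh 1 ≤ x * Real.arsinh 1 := by
  have ht : 0 < Real.arsinh 1 := Real.arsinh_pos_iff.2 one_pos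
  have : (1 : ℝ) ≤ x := by exact_mod_cast hx
  nlinarith

theorem chainResistance_lt_shift_of_odd (n : ℕ) {σ : ℝ} (hσ : σ = 1 ∨ σ = -1) {a b a' b' : ℤ}
    (hab : a < b) (ha : 2 ∣ a) (hb : ¬2 ∣ b) (hpos : 2 * n < a + b + 2) (ha' : a' = a + 2)
    (hb' : b' = b + 2) : chainResistance n σ a b < chainResistance n σ a' b' := by
  subst ha' hb'
  rw [← even_iff_two_dvd] at ha hb
  have ht : 0 < Real.arsinh 1 := Real.arsinh_pos_iff.2 one_pos
  have hx : Real.arsinh 1 ≤ (a + b + 2 - 2 * n) * Real.arsinh 1 := by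
    exact_mod_cast arsinh_one_le_mul (x := a + b + 2 - 2 * n) (by omega)
  have hd : Real.arsinh 1 ≤ (b - a) * Real.arsinh 1 := by
    exact_mod_cast arsinh_one_le_mul (x := b - a) (by omega)
  have hs := Real.sinh_pos_iff.2 (ht.trans_le hx)
  have hsd := Real.sinh_pos_iff.2 (ht.trans_le hd)
  have hC : √2 ≤ Real.cosh ((b - a) * Real.arsinh 1) := by
    rw [← cosh_arsinh_one, Real.cosh_le_cosh, abs_of_pos ht, abs_of_pos (ht.trans_le hd)]
    exact hd
  have h2 : 0 < √2 := by positivity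
  rw [← sub_pos, chainResistance_add_two_sub_of_odd n σ hab.le ha hb]
  apply mul_pos (sinh_div_greenWronskian_pos n)
  have : 0 < 3 / 4 * Real.cosh ((b - a) * Real.arsinh 1) - σ * (√2 / 2) := by
    rcases hσ with rfl | rfl <;> linarith
  have hcx := Real.cosh_pos ((a + b + 2 - 2 * n) * Real.arsinh 1)
  positivity

/-- To the left of the centre the two summands of `chainResistance_add_two_sub_of_odd` compete. The
`sinh` term wins because `cosh y ≤ √2 * sinh y` once `y ≥ arsinh 1`; for `σ = 1` this needs
`a + 2 ≤ b`, since for `b = a + 1` there is equality just left of the centre. -/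
theorem chainResistance_shift_lt_of_odd (n : ℕ) {σ : ℝ} {a b a' b' : ℤ}
    (hσ : σ = 1 ∧ a + 2 ≤ b ∨ σ = -1 ∧ a ≤ b) (ha : 2 ∣ a) (hb : ¬2 ∣ b)
    (hneg : a + b + 2 < 2 * n) (ha' : a' = a + 2) (hb' : b' = b + 2) :
    chainResistance n σ a' b' < chainResistance n σ a b := by
  subst ha' hb'
  rw [← even_iff_two_dvd] at ha hb
  have ht : 0 < Real.arsinh 1 := Real.arsinh_pos_iff.2 one_pos
  have hab : a < b := lt_of_le_of_ne (by omega) (by rintro rfl; exact hb ha)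
  obtain ⟨y, hy⟩ : ∃ y, y = (2 * n - a - b - 2) * Real.arsinh 1 := ⟨_, rfl⟩
  have hy1 : Real.arsinh 1 ≤ y := by
    rw [hy]
    exact_mod_cast arsinh_one_le_mul (x := 2 * n - a - b - 2) (by omega)
  have hs : 1 ≤ Real.sinh y := by
    rw [← Real.sinh_arsinh 1, Real.sinh_le_sinh]; exact hy1
  have h2 : 0 < √2 := by positivity
  have h22 : √2 * √2 = 2 := Real.mul_self_sqrt (by norm_num)
  have h2lt : √2 < 3 / 2 := by rw [Real.sqrt_lt' (by norm_num)]; norm_num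
  have hcs : Real.cosh y ≤ √2 * Real.sinh y := by
    apply abs_le_of_sq_le_sq' _ (by positivity) |>.2
    rw [Real.cosh_sq, mul_pow, Real.sq_sqrt (by norm_num)]
    nlinarith
  have hSC := Real.sinh_lt_cosh ((b - a) * Real.arsinh 1)
  have hC := Real.cosh_pos ((b - a) * Real.arsinh 1)
  have hA : σ * (√2 / 2) < (3 - √2) / 4 * Real.cosh ((b - a) * Real.arsinh 1) := by
    rcases hσ with ⟨rfl, h⟩ | ⟨rfl, h⟩
    · have hC3 : 3 ≤ Real.cosh ((b - a) * Real.arsinh 1) := by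
        have e : Real.cosh (2 * Real.arsinh 1) = 3 := by
          rw [Real.cosh_two_mul, cosh_arsinh_one, Real.sinh_arsinh, Real.sq_sqrt (by norm_num)]
          norm_num
        have : (2 : ℝ) ≤ b - a := by
          have : (2 : ℤ) ≤ b - a := by omega
          exact_mod_cast this
        rw [← e, Real.cosh_le_cosh, abs_of_nonneg (by positivity), abs_of_nonneg (by positivity)]
        gcongr
      nlinarith
    · nlinarith
  have hS0 : 0 ≤ Real.sinh ((b - a) * Real.arsinh 1) := by
    apply Real.sinh_nonneg_iff.2
    have : (0 : ℝ) ≤ b - a := by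
      have : (0 : ℤ) ≤ b - a := by omega
      exact_mod_cast this
    positivity
  rw [← sub_neg, chainResistance_add_two_sub_of_odd n σ hab.le ha hb,
    show ((a + b + 2 - 2 * n) * Real.arsinh 1 : ℝ) = -y by rw [hy]; ring, Real.sinh_neg,
    Real.cosh_neg]
  apply mul_neg_of_pos_of_neg (sinh_div_greenWronskian_pos n)
  have h5 : Real.sinh ((b - a) * Real.arsinh 1) * Real.cosh y
      ≤ Real.cosh ((b - a) * Real.arsinh 1) * (√2 * Real.sinh y) :=
    mul_le_mul hSC.le hcs (Real.cosh_pos y).le hC.le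
  have h6 := mul_lt_mul_of_pos_right hA (show 0 < Real.sinh y by linarith)
  linarith

/-- For `p_i` and `u_i` the increment is antisymmetric about `a + 2 = n` and not about
`a + b + 2 = 2 n`, which is why this case stands apart. -/
theorem chainResistance_add_two_sub_of_adjacent (n : ℕ) {a : ℤ} (ha : Even a) :
    chainResistance n 1 (a + 2) (a + 3) - chainResistance n 1 a (a + 1)
      = Real.sinh (2 * Real.arsinh 1) / greenWronskian n *
        (Real.sinh ((2 * a + 4 - 2 * n) * Real.arsinh 1) / 4) := by
  have h := chainResistance_add_two_sub_of_odd n 1 (b := a + 1) (by omega) ha (by grind)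
  rw [show a + 1 + 2 = a + 3 by ring] at h
  rw [h, show ((2 * a + 4 - 2 * n) * Real.arsinh 1 : ℝ)
      = (a + (a + 1 : ℤ) + 2 - 2 * n) * Real.arsinh 1 + Real.arsinh 1 by push_cast; ring,
    Real.sinh_add, show (((a + 1 : ℤ) : ℝ) - a) * Real.arsinh 1 = Real.arsinh 1 by push_cast; ring,
    cosh_arsinh_one, Real.sinh_arsinh]
  ring

theorem chainResistance_shift_lt_of_adjacent (n : ℕ) {a : ℤ} (ha : 2 ∣ a) (hneg : a + 2 < n) :
    chainResistance n 1 (a + 2) (a + 3) < chainResistance n 1 a (a + 1) := by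
  rw [← sub_neg, chainResistance_add_two_sub_of_adjacent n (even_iff_two_dvd.2 ha)]
  apply mul_neg_of_pos_of_neg (sinh_div_greenWronskian_pos n)
  apply div_neg_of_neg_of_pos _ four_pos
  rw [Real.sinh_neg_iff]
  apply mul_neg_of_neg_of_pos _ (Real.arsinh_pos_iff.2 one_pos)
  have : (2 * a + 4 - 2 * n : ℤ) < 0 := by omega
  exact_mod_cast this

theorem chainResistance_shift_eq_of_adjacent (n : ℕ) {a : ℤ} (ha : 2 ∣ a) (h0 : a + 2 = n) :
    chainResistance n 1 (a + 2) (a + 3) = chainResistance n 1 a (a + 1) := by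
  rw [← sub_eq_zero, chainResistance_add_two_sub_of_adjacent n (even_iff_two_dvd.2 ha)]
  have : (2 * a + 4 - 2 * n : ℝ) = 0 := by
    have : (2 * a + 4 - 2 * n : ℤ) = 0 := by omega
    exact_mod_cast this
  rw [this, zero_mul, Real.sinh_zero, zero_div, mul_zero]

/-! ### The pairs of vertices -/

theorem rL_p_p {n j l : ℕ} {hj : j ≤ n} {hl : l ≤ n} (h : j ≤ l) :
    rL n (pL j hj) (pL l hl) = chainResistance n 1 (2 * j) (2 * l) := by
  have hp : ((pL j hj).pos : ℤ) ≤ (pL l hl).pos := by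
    simp only [pL, HexVertex.pos]; omega
  rw [rL_eq_chainResistance hp]
  simp [pL, HexVertex.pos, HexVertex.side]

theorem rL_q_p {n j l : ℕ} {hj : j ≤ n} {hl : l ≤ n} (h : j ≤ l) :
    rL n (qL j hj) (pL l hl) = chainResistance n (-1) (2 * j) (2 * l) := by
  have hp : ((qL j hj).pos : ℤ) ≤ (pL l hl).pos := by
    simp only [qL, pL, HexVertex.pos]; omega
  rw [rL_eq_chainResistance hp]
  simp [qL, pL, HexVertex.pos, HexVertex.side]

theorem rL_u_u {n j l : ℕ} {hj : j < n} {hl : l < n} (h : j ≤ l) :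
    rL n (uL j hj) (uL l hl) = chainResistance n 1 (2 * j + 1) (2 * l + 1) := by
  have hp : ((uL j hj).pos : ℤ) ≤ (uL l hl).pos := by
    simp only [uL, HexVertex.pos]; omega
  rw [rL_eq_chainResistance hp]
  simp [uL, HexVertex.pos, HexVertex.side]

theorem rL_v_u {n j l : ℕ} {hj : j < n} {hl : l < n} (h : j ≤ l) :
    rL n (vL j hj) (uL l hl) = chainResistance n (-1) (2 * j + 1) (2 * l + 1) := by
  have hp : ((vL j hj).pos : ℤ) ≤ (uL l hl).pos := by
    simp only [vL, uL, HexVertex.pos]; omega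
  rw [rL_eq_chainResistance hp]
  simp [vL, uL, HexVertex.pos, HexVertex.side]

theorem rL_p_u {n j l : ℕ} {hj : j ≤ n} {hl : l < n} (h : j ≤ l) :
    rL n (pL j hj) (uL l hl) = chainResistance n 1 (2 * j) (2 * l + 1) := by
  have hp : ((pL j hj).pos : ℤ) ≤ (uL l hl).pos := by
    simp only [pL, uL, HexVertex.pos]; omega
  rw [rL_eq_chainResistance hp]
  simp [pL, uL, HexVertex.pos, HexVertex.side]

theorem rL_p_v {n j l : ℕ} {hj : j ≤ n} {hl : l < n} (h : j ≤ l) :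
    rL n (pL j hj) (vL l hl) = chainResistance n (-1) (2 * j) (2 * l + 1) := by
  have hp : ((pL j hj).pos : ℤ) ≤ (vL l hl).pos := by
    simp only [pL, vL, HexVertex.pos]; omega
  rw [rL_eq_chainResistance hp]
  simp [pL, vL, HexVertex.pos, HexVertex.side]

theorem lemma3p1 (n : ℕ) :
    -- p-p pairs
    ((∀ (k : ℕ) (_ : 0 < k) (_ : k ≤ n),
        (∀ (j : ℕ) (_ : j + 1 ≤ (n - k) / 2),
          rL n (pL (j + 1)) (pL (j + 1 + k)) < rL n (pL j) (pL (j + k))) ∧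
        rL n (pL ((n - k) / 2)) (pL ((n - k) / 2 + k))
          = rL n (pL ((n - k + 1) / 2)) (pL ((n - k + 1) / 2 + k)) ∧
        (∀ (j : ℕ) (_ : (n - k + 1) / 2 ≤ j) (_ : j + 1 + k ≤ n),
          rL n (pL j) (pL (j + k)) < rL n (pL (j + 1)) (pL (j + 1 + k)))) ∧
      (∀ (j k k' : ℕ) (_ : 0 < k) (_ : k < k') (_ : j + k' ≤ n),
          rL n (pL j) (pL (j + k)) < rL n (pL j) (pL (j + k'))) ∧
      (∀ (k k' : ℕ) (_ : 0 < k) (_ : k < k') (_ : k' ≤ n),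
          rL n (pL ((n - k) / 2)) (pL ((n - k) / 2 + k))
            < rL n (pL ((n - k') / 2)) (pL ((n - k') / 2 + k')))) ∧
    -- q-p pairs
    ((∀ (k : ℕ) (_ : k ≤ n),
        (∀ (j : ℕ) (_ : j + 1 ≤ (n - k) / 2),
          rL n (qL (j + 1)) (pL (j + 1 + k)) < rL n (qL j) (pL (j + k))) ∧
        rL n (qL ((n - k) / 2)) (pL ((n - k) / 2 + k))
          = rL n (qL ((n - k + 1) / 2)) (pL ((n - k + 1) / 2 + k)) ∧
        (∀ (j : ℕ) (_ : (n - k + 1) / 2 ≤ j) (_ : j + 1 + k ≤ n),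
          rL n (qL j) (pL (j + k)) < rL n (qL (j + 1)) (pL (j + 1 + k)))) ∧
      (∀ (j k k' : ℕ) (_ : k < k') (_ : j + k' ≤ n),
          rL n (qL j) (pL (j + k)) < rL n (qL j) (pL (j + k'))) ∧
      (∀ (k k' : ℕ) (_ : k < k') (_ : k' ≤ n),
          rL n (qL ((n - k) / 2)) (pL ((n - k) / 2 + k))
            < rL n (qL ((n - k') / 2)) (pL ((n - k') / 2 + k')))) ∧
    -- u-u pairs
    ((∀ (k : ℕ) (_ : 0 < k) (_ : k < n),
        (∀ (j : ℕ) (_ : j + 1 ≤ (n - 1 - k) / 2),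
          rL n (uL (j + 1)) (uL (j + 1 + k)) < rL n (uL j) (uL (j + k))) ∧
        rL n (uL ((n - 1 - k) / 2)) (uL ((n - 1 - k) / 2 + k))
          = rL n (uL ((n - k) / 2)) (uL ((n - k) / 2 + k)) ∧
        (∀ (j : ℕ) (_ : (n - k) / 2 ≤ j) (_ : j + 1 + k < n),
          rL n (uL j) (uL (j + k)) < rL n (uL (j + 1)) (uL (j + 1 + k)))) ∧
      (∀ (j k k' : ℕ) (_ : k < k') (_ : j + k' < n),
          rL n (uL j) (uL (j + k)) < rL n (uL j) (uL (j + k'))) ∧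
      (∀ (k k' : ℕ) (_ : k < k') (_ : k' < n),
          rL n (uL ((n - k) / 2)) (uL ((n - k) / 2 + k))
            < rL n (uL ((n - k') / 2)) (uL ((n - k') / 2 + k')))) ∧
    -- v-u pairs
    ((∀ (k : ℕ) (_ : k < n),
        (∀ (j : ℕ) (_ : j + 1 ≤ (n - 1 - k) / 2),
          rL n (vL (j + 1)) (uL (j + 1 + k)) < rL n (vL j) (uL (j + k))) ∧
        rL n (vL ((n - 1 - k) / 2)) (uL ((n - 1 - k) / 2 + k))
          = rL n (vL ((n - k) / 2)) (uL ((n - k) / 2 + k)) ∧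
        (∀ (j : ℕ) (_ : (n - k) / 2 ≤ j) (_ : j + 1 + k < n),
          rL n (vL j) (uL (j + k)) < rL n (vL (j + 1)) (uL (j + 1 + k)))) ∧
      (∀ (j k k' : ℕ) (_ : k < k') (_ : j + k' < n),
          rL n (vL j) (uL (j + k)) < rL n (vL j) (uL (j + k'))) ∧
      (∀ (k k' : ℕ) (_ : k < k') (_ : k' < n),
          rL n (vL ((n - k) / 2)) (uL ((n - k) / 2 + k))
            < rL n (vL ((n - k') / 2)) (uL ((n - k') / 2 + k')))) ∧
    -- p-u pairs (for k = 0 the chain is symmetric, see the next clause)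
    ((∀ (k : ℕ) (_ : 0 < k) (_ : k < n),
        (∀ (j : ℕ) (_ : j + 1 ≤ (n - k) / 2),
          rL n (pL (j + 1)) (uL (j + 1 + k)) < rL n (pL j) (uL (j + k))) ∧
        (∀ (j : ℕ) (_ : (n - k) / 2 ≤ j) (_ : j + 1 + k < n),
          rL n (pL j) (uL (j + k)) < rL n (pL (j + 1)) (uL (j + 1 + k)))) ∧
      ((_ : 0 < n) →
        (∀ (j : ℕ) (_ : j + 1 ≤ (n - 1) / 2),
          rL n (pL (j + 1)) (uL (j + 1)) < rL n (pL j) (uL j)) ∧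
        rL n (pL ((n - 1) / 2)) (uL ((n - 1) / 2)) = rL n (pL (n / 2)) (uL (n / 2)) ∧
        (∀ (j : ℕ) (_ : n / 2 ≤ j) (_ : j + 1 < n),
          rL n (pL j) (uL j) < rL n (pL (j + 1)) (uL (j + 1)))) ∧
      (∀ (j k k' : ℕ) (_ : k < k') (_ : j + k' < n),
          rL n (pL j) (uL (j + k)) < rL n (pL j) (uL (j + k'))) ∧
      (∀ (k k' : ℕ) (_ : k < k') (_ : k' < n),
          rL n (pL ((n - 1 - k) / 2)) (uL ((n - 1 - k) / 2 + k))
            < rL n (pL ((n - 1 - k') / 2)) (uL ((n - 1 - k') / 2 + k'))) ∧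
      (∀ (k k' : ℕ) (_ : k < k') (_ : k' < n),
          rL n (pL ((n - k) / 2)) (uL ((n - k) / 2 + k))
            < rL n (pL ((n - k') / 2)) (uL ((n - k') / 2 + k')))) ∧
    -- p-v pairs
    ((∀ (k : ℕ) (_ : k < n),
        (∀ (j : ℕ) (_ : j + 1 ≤ (n - k) / 2),
          rL n (pL (j + 1)) (vL (j + 1 + k)) < rL n (pL j) (vL (j + k))) ∧
        (∀ (j : ℕ) (_ : (n - k) / 2 ≤ j) (_ : j + 1 + k < n),
          rL n (pL j) (vL (j + k)) < rL n (pL (j + 1)) (vL (j + 1 + k)))) ∧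
      (∀ (j k k' : ℕ) (_ : k < k') (_ : j + k' < n),
          rL n (pL j) (vL (j + k)) < rL n (pL j) (vL (j + k'))) ∧
      (∀ (k k' : ℕ) (_ : k < k') (_ : k' < n),
          rL n (pL ((n - 1 - k) / 2)) (vL ((n - 1 - k) / 2 + k))
            < rL n (pL ((n - 1 - k') / 2)) (vL ((n - 1 - k') / 2 + k'))) ∧
      (∀ (k k' : ℕ) (_ : k < k') (_ : k' < n),
          rL n (pL ((n - k) / 2)) (vL ((n - k) / 2 + k))
            < rL n (pL ((n - k') / 2)) (vL ((n - k') / 2 + k')))) := by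
  refine ⟨?_, ?_, ?_, ?_, ?_, ?_⟩
  · refine ⟨fun k hk0 hk => ⟨fun j hj => ?_, ?_, fun j hj hjk => ?_⟩, fun j k k' hk0 hkk hk => ?_,
      fun k k' hk0 hkk hk => ?_⟩
    · rw [rL_p_p (by omega), rL_p_p (by omega)]
      exact chainResistance_shift_lt_of_even n (by omega) (.inl ⟨rfl, by omega⟩) (by omega)
        (by omega) (by omega)
    · rw [rL_p_p (by omega), rL_p_p (by omega)]
      rw [← chainResistance_reflect]
      congr 1 <;> omega
    · rw [rL_p_p (by omega), rL_p_p (by omega)]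
      exact chainResistance_lt_shift_of_even n (by omega) (.inl ⟨rfl, by omega⟩) (by omega)
        (by omega) (by omega)
    · rw [rL_p_p (by omega), rL_p_p (by omega)]
      exact chainResistance_lt_of_nested n (.inl rfl) (by omega) (by omega) (by omega) (by omega)
          (by omega) (by omega) (by omega) (by omega)
    · rw [rL_p_p (by omega), rL_p_p (by omega)]
      exact chainResistance_lt_of_nested n (.inl rfl) (by omega) (by omega) (by omega) (by omega)
          (by omega) (by omega) (by omega) (by omega)
  · refine ⟨fun k hk => ⟨fun j hj => ?_, ?_, fun j hj hjk => ?_⟩, fun j k k' hkk hk => ?_,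
      fun k k' hkk hk => ?_⟩
    · rw [rL_q_p (by omega), rL_q_p (by omega)]
      exact chainResistance_shift_lt_of_even n (by omega) (.inr ⟨rfl, by omega⟩) (by omega)
        (by omega) (by omega)
    · rw [rL_q_p (by omega), rL_q_p (by omega)]
      rw [← chainResistance_reflect]
      congr 1 <;> omega
    · rw [rL_q_p (by omega), rL_q_p (by omega)]
      exact chainResistance_lt_shift_of_even n (by omega) (.inr ⟨rfl, by omega⟩) (by omega)
        (by omega) (by omega)
    · rw [rL_q_p (by omega), rL_q_p (by omega)]
      exact chainResistance_lt_of_nested n (.inr rfl) (by omega) (by omega) (by omega) (by omega)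
          (by omega) (by omega) (by omega) (by omega)
    · rw [rL_q_p (by omega), rL_q_p (by omega)]
      exact chainResistance_lt_of_nested n (.inr rfl) (by omega) (by omega) (by omega) (by omega)
          (by omega) (by omega) (by omega) (by omega)
  · refine ⟨fun k hk0 hk => ⟨fun j hj => ?_, ?_, fun j hj hjk => ?_⟩, fun j k k' hkk hk => ?_,
      fun k k' hkk hk => ?_⟩
    · rw [rL_u_u (by omega), rL_u_u (by omega)]
      exact chainResistance_shift_lt_of_even n (by omega) (.inl ⟨rfl, by omega⟩) (by omega)
        (by omega) (by omega)
    · rw [rL_u_u (by omega), rL_u_u (by omega)]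
      rw [← chainResistance_reflect]
      congr 1 <;> omega
    · rw [rL_u_u (by omega), rL_u_u (by omega)]
      exact chainResistance_lt_shift_of_even n (by omega) (.inl ⟨rfl, by omega⟩) (by omega)
        (by omega) (by omega)
    · rw [rL_u_u (by omega), rL_u_u (by omega)]
      exact chainResistance_lt_of_nested n (.inl rfl) (by omega) (by omega) (by omega) (by omega)
          (by omega) (by omega) (by omega) (by omega)
    · rw [rL_u_u (by omega), rL_u_u (by omega)]
      exact chainResistance_lt_of_nested n (.inl rfl) (by omega) (by omega) (by omega) (by omega)
          (by omega) (by omega) (by omega) (by omega)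
  · refine ⟨fun k hk => ⟨fun j hj => ?_, ?_, fun j hj hjk => ?_⟩, fun j k k' hkk hk => ?_,
      fun k k' hkk hk => ?_⟩
    · rw [rL_v_u (by omega), rL_v_u (by omega)]
      exact chainResistance_shift_lt_of_even n (by omega) (.inr ⟨rfl, by omega⟩) (by omega)
        (by omega) (by omega)
    · rw [rL_v_u (by omega), rL_v_u (by omega)]
      rw [← chainResistance_reflect]
      congr 1 <;> omega
    · rw [rL_v_u (by omega), rL_v_u (by omega)]
      exact chainResistance_lt_shift_of_even n (by omega) (.inr ⟨rfl, by omega⟩) (by omega)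
        (by omega) (by omega)
    · rw [rL_v_u (by omega), rL_v_u (by omega)]
      exact chainResistance_lt_of_nested n (.inr rfl) (by omega) (by omega) (by omega) (by omega)
          (by omega) (by omega) (by omega) (by omega)
    · rw [rL_v_u (by omega), rL_v_u (by omega)]
      exact chainResistance_lt_of_nested n (.inr rfl) (by omega) (by omega) (by omega) (by omega)
          (by omega) (by omega) (by omega) (by omega)
  · refine ⟨fun k hk0 hk => ⟨fun j hj => ?_, fun j hj hjk => ?_⟩, fun hn => ⟨fun j hj => ?_, ?_, fun j hj hjn => ?_⟩,
      fun j k k' hkk hk => ?_, fun k k' hkk hk => ?_, fun k k' hkk hk => ?_⟩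
    · rw [rL_p_u (by omega), rL_p_u (by omega)]
      exact chainResistance_shift_lt_of_odd n (.inl ⟨rfl, by omega⟩) (by omega) (by omega)
        (by omega) (by omega) (by omega)
    · rw [rL_p_u (by omega), rL_p_u (by omega)]
      exact chainResistance_lt_shift_of_odd n (.inl rfl) (by omega) (by omega) (by omega)
        (by omega) (by omega) (by omega)
    · rw [rL_p_u (by omega), rL_p_u (by omega)]
      convert chainResistance_shift_lt_of_adjacent n (a := 2 * j) (by omega) (by omega) using 2
        <;> push_cast <;> ring
    · rcases Nat.even_or_odd n with h | h
      · rw [rL_p_u (by omega), rL_p_u (by omega)]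
        obtain ⟨m, rfl⟩ := h
        convert (chainResistance_shift_eq_of_adjacent (m + m) (a := 2 * m - 2) (by omega)
          (by push_cast; ring)).symm using 2 <;> omega
      · -- for odd `n` the two pairs coincide
        have : (n - 1) / 2 = n / 2 := by grind
        simp only [this]
    · rw [rL_p_u (by omega), rL_p_u (by omega)]
      exact chainResistance_lt_shift_of_odd n (.inl rfl) (by omega) (by omega) (by omega)
        (by omega) (by omega) (by omega)
    · rw [rL_p_u (by omega), rL_p_u (by omega)]
      exact chainResistance_lt_of_nested n (.inl rfl) (by omega) (by omega) (by omega) (by omega)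
          (by omega) (by omega) (by omega) (by omega)
    · rw [rL_p_u (by omega), rL_p_u (by omega)]
      exact chainResistance_lt_of_nested n (.inl rfl) (by omega) (by omega) (by omega) (by omega)
          (by omega) (by omega) (by omega) (by omega)
    · rw [rL_p_u (by omega), rL_p_u (by omega)]
      exact chainResistance_lt_of_nested n (.inl rfl) (by omega) (by omega) (by omega) (by omega)
          (by omega) (by omega) (by omega) (by omega)
  · refine ⟨fun k hk => ⟨fun j hj => ?_, fun j hj hjk => ?_⟩,
      fun j k k' hkk hk => ?_, fun k k' hkk hk => ?_, fun k k' hkk hk => ?_⟩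
    · rw [rL_p_v (by omega), rL_p_v (by omega)]
      exact chainResistance_shift_lt_of_odd n (.inr ⟨rfl, by omega⟩) (by omega) (by omega)
        (by omega) (by omega) (by omega)
    · rw [rL_p_v (by omega), rL_p_v (by omega)]
      exact chainResistance_lt_shift_of_odd n (.inr rfl) (by omega) (by omega) (by omega)
        (by omega) (by omega) (by omega)
    · rw [rL_p_v (by omega), rL_p_v (by omega)]
      exact chainResistance_lt_of_nested n (.inr rfl) (by omega) (by omega) (by omega) (by omega)
          (by omega) (by omega) (by omega) (by omega)
    · rw [rL_p_v (by omega), rL_p_v (by omega)]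
      exact chainResistance_lt_of_nested n (.inr rfl) (by omega) (by omega) (by omega) (by omega)
          (by omega) (by omega) (by omega) (by omega)
    · rw [rL_p_v (by omega), rL_p_v (by omega)]
      exact chainResistance_lt_of_nested n (.inr rfl) (by omega) (by omega) (by omega) (by omega)
          (by omega) (by omega) (by omega) (by omega)
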